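/- Let $n\ge 0$ and let $w$ be a permutation in $S_n$. Write $s_i$ ($1\le i\le n-1$) for the adjacent transposition swapping $i$ and $i+1$, let $\ell(w)$ be the least length of a word $i_1\cdots i_l$ with $w=s_{i_1}\cdots s_{i_l}$ (products are compositions of maps), and call such a word reduced if it has length $\ell(w)$. We identify a word with its product where convenient. The permutation $w$ is boolean if its principal order ideal in the Bruhat order is isomorphic to a finite boolean algebra. A canonical word of $w$ is obtained as a concatenation of runs by the following procedure. If $w$ is the identity, it is the empty word. Otherwise take an arbitrary reduced word $s$ of $w$, and let $a$ be the smallest letter of $s$. (a) If $a+1$ does not appear in $s$, write $w=s_a w'$; the canonical word is the run $a$ followed by the canonical word of $w'$. (b) If $a+1$ appears to the left of $a$ in $s$, let $b\ge a+1$ be the largest number such that $b(b-1)\cdots a$ is a subsequence of $s$, and write $w=(s_b s_{b-1}\cdots s_a)\,w'$; the canonical word is the run $b(b-1)\cdots a$ followed by the canonical word of $w'$. (c) If $a+1$ appears to the right of $a$ in $s$, let $b\ge a+1$ be the largest number such that $a(a+1)\cdots b$ is a subsequence of $s$, and write $w=w'\,(s_a s_{a+1}\cdots s_b)$; the canonical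 word is the canonical word of $w'$ followed by the run $a(a+1)\cdots b$. The runs of the canonical word are the runs produced in these steps. Theorem. Let $w\in S_n$ be boolean. Then the procedure terminates with a sequence of runs that does not depend on the choices of reduced words, and their concatenation is a reduced word of $w$ (the canonical word). Let $P(w)$ and $Q(w)$ be the insertion and recording tableaux of $w(1)w(2)\cdots w(n)$ under the Robinson–Schensted–Knuth correspondence (row insertion). Then the second row of $P(w)$ has the contents $$A=\{\,i+1 : i \text{ is the leftmost entry of a run of the canonical word of } w\,\},$$ and the second row of $Q(w)$ has the contents $$B=\{\,i+1 : i \text{ is the rightmost entry of a run of the canonical word of } w\,\}.$$ Moreover both tableaux have at most two rows, so they are determined by these sets: the first rows of $P(w)$ and $Q(w)$ have the contents $\{1,\dots,n\}\setminus A$ and $\{1,\dots,n\}\setminus B$, respectively. (Here a row that does not exist has empty contents.) -/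

import Mathlib

namespace BooleanRSK

/-- The simple reflection `s_i`, swapping `i` and `i + 1`, for a letter `1 ≤ i ≤ n - 1`. The set
`{1, …, n}` is modelled by `Fin n`, the number `j` being the element with value `j - 1`.
(Letters outside `1, …, n - 1` are excluded in `IsDecomposition`; the value there is immaterial.) -/
def simpleReflection (n i : ℕ) : Equiv.Perm (Fin n) :=
  if h : 1 ≤ i ∧ i < n then Equiv.swap ⟨i - 1, by omega⟩ ⟨i, h.2⟩ else 1

/-- The product `s_{i_1} ⋯ s_{i_l}` of a word `i_1 ⋯ i_l` (the product of permutations is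
composition, the rightmost factor being applied first). -/
def wordProd (n : ℕ) (s : List ℕ) : Equiv.Perm (Fin n) :=
  (s.map (simpleReflection n)).prod

/-- The word `s`, with letters in `{1, …, n - 1}`, is a decomposition of `w`. -/
def IsDecomposition {n : ℕ} (w : Equiv.Perm (Fin n)) (s : List ℕ) : Prop :=
  (∀ i ∈ s, 1 ≤ i ∧ i < n) ∧ wordProd n s = w

/-- The Coxeter length: the least number of letters in a decomposition of `w`. -/
noncomputable def coxeterLength {n : ℕ} (w : Equiv.Perm (Fin n)) : ℕ :=
  sInf {l | ∃ s, IsDecomposition w s ∧ s.length = l}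

/-- `s` is a reduced word of `w`. -/
def IsReducedWord {n : ℕ} (w : Equiv.Perm (Fin n)) (s : List ℕ) : Prop :=
  IsDecomposition w s ∧ s.length = coxeterLength w

/-- The (strong) Bruhat order: generated by `u < u t` for a transposition `t` with
`ℓ(u) < ℓ(u t)`. -/
def BruhatLE {n : ℕ} (u v : Equiv.Perm (Fin n)) : Prop :=
  Relation.ReflTransGen
    (fun x y => ∃ a b : Fin n, a ≠ b ∧ y = x * Equiv.swap a b ∧ coxeterLength x < coxeterLength y)
    u v

/-- `w` is boolean: its principal order ideal in the Bruhat order is isomorphic to a (finite)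
boolean algebra, that is, to the lattice of subsets of a finite set. -/
def IsBoolean {n : ℕ} (w : Equiv.Perm (Fin n)) : Prop :=
  ∃ (k : ℕ) (f : {u : Equiv.Perm (Fin n) // BruhatLE u w} ≃ Finset (Fin k)),
    ∀ u v, BruhatLE u.1 v.1 ↔ f u ⊆ f v

/-- The increasing run `a (a+1) ⋯ b` (for `a ≤ b`). -/
def incRun (a b : ℕ) : List ℕ := List.range' a (b + 1 - a)

/-- The decreasing run `b (b-1) ⋯ a` (for `a ≤ b`). -/
def decRun (a b : ℕ) : List ℕ := (incRun a b).reverse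

/-- `IsCanonicalRuns w L`: the algorithm that constructs the canonical reduced word of `w` can end
with the list of runs `L`, in the order in which they are concatenated; the word itself is
`L.flatten`. In every step `s` is an arbitrary reduced word of the current permutation and `a` is
its smallest letter; `[x, y] <+ s` says that `x` appears to the left of `y` in `s`. -/
inductive IsCanonicalRuns {n : ℕ} : Equiv.Perm (Fin n) → List (List ℕ) → Prop
  /-- Nothing is left to do for the identity. -/
  | one : IsCanonicalRuns 1 []
  /-- `a + 1` does not appear: push the singleton run `a` to the left. -/
  | singleton {w w' : Equiv.Perm (Fin n)} {s : List ℕ} {a : ℕ} {L : List (List ℕ)}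
      (hs : IsReducedWord w s) (ha : IsLeast {x | x ∈ s} a)
      (h : a + 1 ∉ s)
      (hw : w = wordProd n [a] * w') (hL : IsCanonicalRuns w' L) :
      IsCanonicalRuns w ([a] :: L)
  /-- `a + 1` appears to the left of `a`: push the longest decreasing run `b ⋯ (a+1) a` that is a
  subsequence of `s` to the left. -/
  | decreasing {w w' : Equiv.Perm (Fin n)} {s : List ℕ} {a b : ℕ} {L : List (List ℕ)}
      (hs : IsReducedWord w s) (ha : IsLeast {x | x ∈ s} a)
      (h : [a + 1, a].Sublist s)
      (hb : IsGreatest {c | a + 1 ≤ c ∧ (decRun a c).Sublist s} b)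
      (hw : w = wordProd n (decRun a b) * w') (hL : IsCanonicalRuns w' L) :
      IsCanonicalRuns w (decRun a b :: L)
  /-- `a + 1` appears to the right of `a`: push the longest increasing run `a (a+1) ⋯ b` that is a
  subsequence of `s` to the right. -/
  | increasing {w w' : Equiv.Perm (Fin n)} {s : List ℕ} {a b : ℕ} {L : List (List ℕ)}
      (hs : IsReducedWord w s) (ha : IsLeast {x | x ∈ s} a)
      (h : [a, a + 1].Sublist s)
      (hb : IsGreatest {c | a + 1 ≤ c ∧ (incRun a c).Sublist s} b)
      (hw : w = w' * wordProd n (incRun a b)) (hL : IsCanonicalRuns w' L) :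
      IsCanonicalRuns w (L ++ [incRun a b])

/-- Schensted insertion of `x` into a row: `x` replaces the leftmost entry greater than `x`, which
is bumped; if there is none, `x` is put at the end of the row. The result is the new row and the
bumped entry, if any. -/
def insertRow (x : ℕ) : List ℕ → List ℕ × Option ℕ
  | [] => ([x], none)
  | y :: ys =>
    if x < y then (x :: ys, some y)
    else (y :: (insertRow x ys).1, (insertRow x ys).2)

/-- Insertion of `x` into a tableau (the list of its rows, from top to bottom): bumped entries are
inserted into the next row. The result is the new tableau and the index of the row (counted from
`0`) in which the new box is created. -/
def insertTableau (x : ℕ) : List (List ℕ) → List (List ℕ) × ℕ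
  | [] => ([[x]], 0)
  | r :: rs =>
    match insertRow x r with
    | (r', none) => (r' :: rs, 0)
    | (r', some y) => (r' :: (insertTableau y rs).1, (insertTableau y rs).2 + 1)

/-- Put `m` at the end of the row with index `k`, which is a new row if `k` is the number of
rows. -/
def addBox (m : ℕ) : ℕ → List (List ℕ) → List (List ℕ)
  | _, [] => [[m]]
  | 0, r :: rs => (r ++ [m]) :: rs
  | k + 1, r :: rs => r :: addBox m k rs

/-- The pair of RSK tableaux of `w`: the letters `w(1), …, w(n)` are inserted one after the other,
and the box created by `w(j)` gets the entry `j` in the recording tableau. -/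
def rsk {n : ℕ} (w : Equiv.Perm (Fin n)) : List (List ℕ) × List (List ℕ) :=
  (List.finRange n).foldl
    (fun T j =>
      let I := insertTableau ((w j : ℕ) + 1) T.1
      (I.1, addBox ((j : ℕ) + 1) I.2 T.2))
    ([], [])

/-- The insertion tableau `P(w)`. -/
def insertionTableau {n : ℕ} (w : Equiv.Perm (Fin n)) : List (List ℕ) := (rsk w).1

/-- The recording tableau `Q(w)`. -/
def recordingTableau {n : ℕ} (w : Equiv.Perm (Fin n)) : List (List ℕ) := (rsk w).2

/-- The contents of the row with index `k`, counted from `0` (empty if there is no such row). -/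
def rowContents (T : List (List ℕ)) (k : ℕ) : Set ℕ := {x | x ∈ T.getD k []}

/-- `{i + 1 : i is the leftmost entry of a run in L}`. -/
def leftmostSucc (L : List (List ℕ)) : Set ℕ := {m | ∃ r ∈ L, ∃ i, r.head? = some i ∧ m = i + 1}

/-- `{i + 1 : i is the rightmost entry of a run in L}`. -/
def rightmostSucc (L : List (List ℕ)) : Set ℕ :=
  {m | ∃ r ∈ L, ∃ i, r.getLast? = some i ∧ m = i + 1}

end BooleanRSK

/-!
A permutation `w` is boolean only if its reduced words have no repeated letters. Indeed, if its
Bruhat ideal is the lattice of subsets of a `k`-element set, then the prefixes of a reduced word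
form a chain, so that `ℓ(w) ≤ k`; and the `k` atoms of the ideal are simple reflections, whose
letters occur in the word because the property of mapping `{1, …, i}` onto itself is inherited by
smaller elements of the Bruhat order (`preserves_of_bruhatLE`). Hence the word has at least `k`
different letters among at most `k` (`IsBoolean.nodup`). For words without repeated letters, the
letter `i` occurs if and only if the product does not map `{1, …, i}` onto itself, so all such words
of `w` have the same letters, and they are the reduced words of `w` (`isReducedWord_iff`).

In a word without repeated letters, the run that the algorithm chooses commutes to the front or to
the end of the word (`exists_decRun_mul`, `exists_mul_incRun`), and its letters form an interval
`[a, b]` below all remaining letters. So the algorithm ends, and its outcome is described by the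
inductive predicate `Peeling`, which no longer mentions words. The data of a step can be read off
from the one-line notation of `w`: `a` is the least number that is moved, the preimage of `a` is
`a + 1` if and only if the run is decreasing or a single letter, and `b` is `w(a) - 1` or
`w⁻¹(a) - 1` accordingly. Therefore the runs are unique (`Peeling.unique`).

For the tableaux, let `w'` be what remains of `w` after one step. If `w = s_b ⋯ s_a w'`, then the
one-line notation of `w` has `b + 1, a` at the positions `a, a + 1`, and the insertion of `a` bumps
`b + 1`; everything else consists of entries that never move again and of the one-line notation of
`w'`, with its least entry relabelled if `a < b` (`bumps_decRun_mul`). If `w = w' s_a ⋯ s_b`, then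
`a + 1` is bumped at position `b + 1`, and again the rest is as for `w'` (`bumps_mul_incRun`). So the
bumped entries are the successors of the leftmost entries of the runs, and they are bumped at the
successors of the rightmost entries. They increase from one run to the next; hence they are
appended to the second row, and there is no third row (`exists_foldl_insertTableau`). The contents
of the first rows are what is left.
-/

namespace BooleanRSK

/-! ### Words and simple reflections -/

theorem val_simpleReflection {n i : ℕ} (hi : 1 ≤ i ∧ i < n) (x : Fin n) :
    (simpleReflection n i x : ℕ) =
      if (x : ℕ) = i - 1 then i else if (x : ℕ) = i then i - 1 else x := by
  rw [simpleReflection, dif_pos hi, Equiv.swap_apply_def]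
  simp only [Fin.ext_iff]
  split_ifs <;> rfl

theorem simpleReflection_mul_self (n i : ℕ) :
    simpleReflection n i * simpleReflection n i = 1 := by
  unfold simpleReflection
  split_ifs <;> simp

theorem simpleReflection_comm {n i j : ℕ} (h : i + 1 < j ∨ j + 1 < i) :
    simpleReflection n i * simpleReflection n j = simpleReflection n j * simpleReflection n i := by
  by_cases hi : 1 ≤ i ∧ i < n
  · by_cases hj : 1 ≤ j ∧ j < n
    · ext x
      simp only [Equiv.Perm.mul_apply, val_simpleReflection hi, val_simpleReflection hj]
      split_ifs <;> omega
    · simp [simpleReflection, hj]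
  · simp [simpleReflection, hi]

@[simp] theorem wordProd_nil (n : ℕ) : wordProd n [] = 1 := rfl

theorem wordProd_cons (n i : ℕ) (s : List ℕ) :
    wordProd n (i :: s) = simpleReflection n i * wordProd n s := by
  simp [wordProd]

theorem wordProd_append (n : ℕ) (s t : List ℕ) :
    wordProd n (s ++ t) = wordProd n s * wordProd n t := by
  simp [wordProd]

theorem wordProd_reverse (n : ℕ) (s : List ℕ) :
    wordProd n s.reverse = (wordProd n s)⁻¹ := by
  induction s with
  | nil => simp
  | cons i s ih =>
    rw [List.reverse_cons, wordProd_append, ih, wordProd_cons, wordProd_cons, mul_inv_rev,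
      wordProd_nil, mul_one, ← eq_inv_of_mul_eq_one_left (simpleReflection_mul_self n i)]

theorem exists_isDecomposition {n : ℕ} (w : Equiv.Perm (Fin n)) : ∃ s, IsDecomposition w s := by
  rcases n with _ | n
  · exact ⟨[], by simp, Subsingleton.elim _ _⟩
  · have hw : w ∈ Submonoid.closure
        (Set.range fun i : Fin n => Equiv.swap i.castSucc i.succ) := by
      rw [Equiv.Perm.mclosure_swap_castSucc_succ]; trivial
    induction hw using Submonoid.closure_induction with
    | mem x hx =>
      obtain ⟨i, rfl⟩ := hx
      have hi : 1 ≤ (i : ℕ) + 1 ∧ (i : ℕ) + 1 < n + 1 := by omega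
      refine ⟨[(i : ℕ) + 1], by simp, ?_⟩
      rw [wordProd_cons, wordProd_nil, mul_one, simpleReflection, dif_pos hi]
      rfl
    | one => exact ⟨[], by simp, rfl⟩
    | mul x y _ _ hx hy =>
      obtain ⟨s, hs, rfl⟩ := hx
      obtain ⟨t, ht, rfl⟩ := hy
      refine ⟨s ++ t, fun i hi => ?_, wordProd_append _ s t⟩
      rcases List.mem_append.1 hi with h | h
      exacts [hs i h, ht i h]

theorem exists_isReducedWord {n : ℕ} (w : Equiv.Perm (Fin n)) : ∃ s, IsReducedWord w s := by
  obtain ⟨s, hs⟩ := exists_isDecomposition w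
  obtain ⟨t, ht, htl⟩ := Nat.sInf_mem
    (s := {l | ∃ s, IsDecomposition w s ∧ s.length = l}) ⟨_, s, hs, rfl⟩
  exact ⟨t, ht, htl⟩

theorem coxeterLength_le {n : ℕ} {w : Equiv.Perm (Fin n)} {s : List ℕ}
    (hs : IsDecomposition w s) : coxeterLength w ≤ s.length :=
  Nat.sInf_le ⟨s, hs, rfl⟩

/-- Exchange property: if `w` inverts `a < b`, then a letter can be deleted from any word of `w`
to give a word of `w * swap a b`, namely the letter that makes the images of `a` and `b` cross. -/
theorem exchange {n : ℕ} {s : List ℕ} (hs : ∀ i ∈ s, 1 ≤ i ∧ i < n) {a b : Fin n} (hab : a < b)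
    (h : wordProd n s b < wordProd n s a) :
    ∃ t, IsDecomposition (wordProd n s * Equiv.swap a b) t ∧ t.length < s.length := by
  induction s with
  | nil => simp at h; omega
  | cons i s ih =>
    rw [List.forall_mem_cons] at hs
    by_cases h' : wordProd n s b < wordProd n s a
    · obtain ⟨t, ⟨ht, htp⟩, htl⟩ := ih hs.2 h'
      refine ⟨i :: t, ⟨List.forall_mem_cons.2 ⟨hs.1, ht⟩, ?_⟩, by simpa using htl⟩
      rw [wordProd_cons, wordProd_cons, htp, mul_assoc]
    · refine ⟨s, ⟨hs.2, ?_⟩, by simp⟩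
      have hne : wordProd n s a ≠ wordProd n s b := fun e => hab.ne ((wordProd n s).injective e)
      rw [wordProd_cons, Equiv.Perm.mul_apply, Equiv.Perm.mul_apply, Fin.lt_def,
        val_simpleReflection hs.1, val_simpleReflection hs.1] at h
      have hne' := Fin.val_ne_of_ne hne
      rw [Fin.lt_def] at h'
      have ha : ((wordProd n s a : Fin n) : ℕ) = i - 1 ∧ ((wordProd n s b : Fin n) : ℕ) = i := by
        split_ifs at h <;> omega
      have hsw : simpleReflection n i = Equiv.swap (wordProd n s a) (wordProd n s b) := by
        rw [simpleReflection, dif_pos hs.1]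
        congr 1
        · exact Fin.ext ha.1.symm
        · exact Fin.ext ha.2.symm
      rw [wordProd_cons, hsw, ← Equiv.mul_swap_eq_swap_mul, mul_assoc, Equiv.swap_mul_self, mul_one]

/-! ### Cuts -/

/-- The permutation `w` maps the initial segment `{1, …, i}` onto itself. -/
def Preserves {n : ℕ} (w : Equiv.Perm (Fin n)) (i : ℕ) : Prop :=
  ∀ x : Fin n, (w x : ℕ) < i ↔ (x : ℕ) < i

theorem Preserves.mul {n i : ℕ} {u v : Equiv.Perm (Fin n)} (hu : Preserves u i)
    (hv : Preserves v i) : Preserves (u * v) i :=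
  fun x => (hu (v x)).trans (hv x)

theorem Preserves.inv {n i : ℕ} {u : Equiv.Perm (Fin n)} (hu : Preserves u i) :
    Preserves u⁻¹ i := fun x => by
  simpa using (hu (u⁻¹ x)).symm

theorem preserves_simpleReflection {n i j : ℕ} (hj : 1 ≤ j ∧ j < n) :
    Preserves (simpleReflection n j) i ↔ i ≠ j := by
  constructor
  · rintro h rfl
    have := h ⟨i, hj.2⟩
    rw [val_simpleReflection hj] at this
    simp only at this
    split_ifs at this <;> omega
  · intro h x
    rw [val_simpleReflection hj]
    split_ifs <;> omega

theorem preserves_of_notMem {n i : ℕ} {s : List ℕ} (hs : ∀ j ∈ s, 1 ≤ j ∧ j < n) (hi : i ∉ s) :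
    Preserves (wordProd n s) i := by
  induction s with
  | nil => exact fun x => Iff.rfl
  | cons j s ih =>
    rw [List.forall_mem_cons] at hs
    rw [List.mem_cons, not_or] at hi
    rw [wordProd_cons]
    exact ((preserves_simpleReflection hs.1).2 hi.1).mul (ih hs.2 hi.2)

theorem mem_iff_not_preserves {n i : ℕ} {s : List ℕ} (hs : ∀ j ∈ s, 1 ≤ j ∧ j < n)
    (hn : s.Nodup) : i ∈ s ↔ ¬ Preserves (wordProd n s) i := by
  refine ⟨fun hi hp => ?_, fun h => by_contra fun hi => h (preserves_of_notMem hs hi)⟩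
  obtain ⟨u, v, rfl⟩ := List.append_of_mem hi
  have hiv : i ∉ u ∧ i ∉ v := by
    rw [List.nodup_append] at hn
    obtain ⟨_, h2, h3⟩ := hn
    exact ⟨fun h => h3 i h i (by simp) rfl, (List.nodup_cons.1 h2).1⟩
  have hu := preserves_of_notMem (n := n) (fun j hj => hs j (by simp [hj])) hiv.1
  have hv := preserves_of_notMem (n := n) (fun j hj => hs j (by simp [hj])) hiv.2
  refine (preserves_simpleReflection (hs i (by simp))).1 ?_ rfl
  have := (hu.inv.mul hp).mul hv.inv
  rwa [wordProd_append, wordProd_cons, inv_mul_cancel_left, mul_inv_cancel_right] at this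

/-- If one word of `w` has no repeated letters, then the reduced words of `w` are exactly its words
without repeated letters, and they all have the same letters. -/
theorem isReducedWord_iff {n : ℕ} {w : Equiv.Perm (Fin n)} {s t : List ℕ}
    (hs : IsDecomposition w s) (hn : s.Nodup) :
    IsReducedWord w t ↔ IsDecomposition w t ∧ t.Nodup := by
  have key : ∀ t, IsDecomposition w t → s.length ≤ t.length ∧
      (t.length = s.length → t.Nodup) := by
    intro t ht
    have hsub : s.toFinset ⊆ t.toFinset := fun i hi => by
      rw [List.mem_toFinset] at hi ⊢
      by_contra hit
      have := preserves_of_notMem ht.1 hit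
      rw [ht.2, ← hs.2] at this
      exact (mem_iff_not_preserves hs.1 hn).1 hi this
    have h1 := Finset.card_le_card hsub
    rw [List.toFinset_card_of_nodup hn] at h1
    refine ⟨h1.trans t.toFinset_card_le, fun h => ?_⟩
    rw [← Multiset.coe_nodup, ← Multiset.toFinset_card_eq_card_iff_nodup]
    exact le_antisymm t.toFinset_card_le (by simpa [h] using h1)
  have hl : coxeterLength w = s.length := by
    obtain ⟨r, hr, hrl⟩ := exists_isReducedWord w
    exact le_antisymm (coxeterLength_le hs) (hrl ▸ (key r hr).1)
  constructor
  · rintro ⟨h1, h2⟩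
    exact ⟨h1, (key t h1).2 (h2.trans hl)⟩
  · rintro ⟨h1, h2⟩
    refine ⟨h1, hl ▸ ?_⟩
    have : t.Perm s := by
      rw [List.perm_ext_iff_of_nodup h2 hn]
      intro i
      rw [mem_iff_not_preserves h1.1 h2, mem_iff_not_preserves hs.1 hn, h1.2, hs.2]
    exact this.length_eq

/-! ### Boolean permutations -/

theorem lt_of_coxeterLength_lt {n : ℕ} {x : Equiv.Perm (Fin n)} {a b : Fin n} (hab : a < b)
    (h : coxeterLength x < coxeterLength (x * Equiv.swap a b)) : x a < x b := by
  by_contra hlt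
  obtain ⟨s, ⟨hs, hsx⟩, hsl⟩ := exists_isReducedWord x
  have hne : x a ≠ x b := fun e => hab.ne (x.injective e)
  obtain ⟨t, ht, htl⟩ := exchange hs hab (by rw [hsx]; omega)
  rw [hsx] at ht
  have := coxeterLength_le ht
  omega

theorem preserves_of_bruhatLE {n i : ℕ} {u v : Equiv.Perm (Fin n)} (h : BruhatLE u v)
    (hv : Preserves v i) : Preserves u i := by
  induction h using Relation.ReflTransGen.head_induction_on with
  | refl => exact hv
  | @head x y hxy _ ih =>
    have key : ∀ a b : Fin n, a < b → y = x * Equiv.swap a b →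
        coxeterLength x < coxeterLength y → Preserves x i := by
      rintro a b hab rfl hl
      have hlt := lt_of_coxeterLength_lt hab hl
      have ha := ih a
      have hb := ih b
      simp only [Equiv.Perm.mul_apply, Equiv.swap_apply_left, Equiv.swap_apply_right] at ha hb
      -- the images of `a` and `b` are inverted, so the cut `i` does not separate `a` from `b`
      have hsw : Preserves (Equiv.swap a b) i := by
        intro z
        rw [Equiv.swap_apply_def]
        split_ifs with h1 h2
        · subst h1; omega
        · subst h2; omega
        · rfl
      simpa using ih.mul hsw
    obtain ⟨a, b, hne, hy, hl⟩ := hxy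
    rcases lt_or_gt_of_ne hne with h | h
    · exact key a b h hy hl
    · exact key b a h (by rw [hy, Equiv.swap_comm]) hl

theorem IsReducedWord.prefix {n : ℕ} {w : Equiv.Perm (Fin n)} {s t : List ℕ}
    (h : IsReducedWord w (s ++ t)) : IsReducedWord (wordProd n s) s := by
  obtain ⟨⟨h1, h2⟩, h3⟩ := h
  have hs : IsDecomposition (wordProd n s) s := ⟨fun i hi => h1 i (by simp [hi]), rfl⟩
  refine ⟨hs, le_antisymm ?_ (coxeterLength_le hs)⟩
  obtain ⟨r, ⟨hr, hrp⟩, hrl⟩ := exists_isReducedWord (wordProd n s)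
  have : IsDecomposition w (r ++ t) := by
    refine ⟨fun i hi => ?_, by rw [wordProd_append, hrp, ← wordProd_append, h2]⟩
    rcases List.mem_append.1 hi with h | h
    exacts [hr i h, h1 i (by simp [h])]
  have := coxeterLength_le this
  rw [← h3] at this
  simp only [List.length_append] at this
  omega

theorem IsReducedWord.bruhatLE_prefix {n : ℕ} {w : Equiv.Perm (Fin n)} {s t : List ℕ}
    (h : IsReducedWord w (s ++ t)) : BruhatLE (wordProd n s) w := by
  induction t generalizing s with
  | nil =>
    rw [List.append_nil] at h
    rw [h.1.2]
    exact .refl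
  | cons i t ih =>
    have h' : IsReducedWord w ((s ++ [i]) ++ t) := by simpa using h
    refine .head ?_ (ih h')
    have hi : 1 ≤ i ∧ i < n := h.1.1 i (by simp)
    refine ⟨⟨i - 1, by omega⟩, ⟨i, hi.2⟩, by simp [Fin.ext_iff]; omega, ?_, ?_⟩
    · rw [wordProd_append, wordProd_cons, wordProd_nil, mul_one, simpleReflection, dif_pos hi]
    · rw [← h.prefix.2, ← h'.prefix.2]
      simp

theorem one_bruhatLE {n : ℕ} (w : Equiv.Perm (Fin n)) : BruhatLE 1 w := by
  obtain ⟨s, hs⟩ := exists_isReducedWord w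
  exact IsReducedWord.bruhatLE_prefix (s := []) hs

theorem BruhatLE.trans {n : ℕ} {u v w : Equiv.Perm (Fin n)} (h : BruhatLE u v)
    (h' : BruhatLE v w) : BruhatLE u w :=
  Relation.ReflTransGen.trans h h'

/-- A boolean permutation has no reduced word with repeated letters: the prefixes of a reduced word
form a chain of `ℓ(w) + 1` elements in its ideal, and the atoms of the ideal are simple reflections
whose letters occur in the word. If the ideal is the lattice of subsets of a `k`-element set, then
this gives `ℓ(w) ≤ k` and `k ≤ #letters`. -/
theorem IsBoolean.nodup {n : ℕ} {w : Equiv.Perm (Fin n)} (hw : IsBoolean w) {s : List ℕ}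
    (hs : IsReducedWord w s) : s.Nodup := by
  obtain ⟨k, f, hf⟩ := hw
  have hone : ∀ A : Finset (Fin k), f ⟨1, one_bruhatLE w⟩ ⊆ A := fun A => by
    have := (hf ⟨1, one_bruhatLE w⟩ (f.symm A)).1 (one_bruhatLE _)
    rwa [f.apply_symm_apply] at this
  have hchain : ∀ t u (h : s = t ++ u),
      t.length ≤ (f ⟨wordProd n t, (h ▸ hs).bruhatLE_prefix⟩).card := by
    intro t
    induction t using List.reverseRecOn with
    | nil => simp
    | append_singleton t i ih =>
      intro u h
      have h' : s = t ++ ([i] ++ u) := by simpa using h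
      rw [List.length_append, List.length_singleton]
      refine Nat.lt_of_le_of_lt (ih _ h') (Finset.card_lt_card ?_)
      have hred := (h ▸ hs).prefix
      refine lt_of_le_of_ne ((hf _ _).1 hred.bruhatLE_prefix) fun e => ?_
      have e' := congrArg coxeterLength (Subtype.ext_iff.1 (f.injective e))
      simp only at e'
      rw [← hred.2, ← hred.prefix.2] at e'
      simp at e'
  have h1 : s.length ≤ k := by
    refine (hchain s [] (by simp)).trans ?_
    simpa using Finset.card_le_univ (f ⟨wordProd n s, _⟩)
  have hatom : ∀ i : Fin k, ∃ j ∈ s, (f.symm {i}).1 = simpleReflection n j := by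
    intro i
    obtain ⟨t, ht⟩ := exists_isReducedWord (f.symm {i}).1
    rcases t with _ | ⟨j, t⟩
    · have h0 : f.symm {i} = ⟨1, one_bruhatLE w⟩ := Subtype.ext ht.1.2.symm
      have := hone ∅
      rw [← h0, f.apply_symm_apply] at this
      simp at this
    · have hj : 1 ≤ j ∧ j < n := ht.1.1 j (by simp)
      have hle : BruhatLE (simpleReflection n j) (f.symm {i}).1 := by
        have := IsReducedWord.bruhatLE_prefix (s := [j]) ht
        rwa [wordProd_cons, wordProd_nil, mul_one] at this
      have hlew := hle.trans (f.symm {i}).2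
      have hsub : f ⟨simpleReflection n j, hlew⟩ ⊆ {i} := by
        have := (hf ⟨simpleReflection n j, hlew⟩ (f.symm {i})).1 hle
        rwa [f.apply_symm_apply] at this
      have hnp := mt (preserves_simpleReflection (n := n) (i := j) hj).1 (by simp)
      refine ⟨j, ?_, ?_⟩
      · by_contra hjs
        refine hnp (preserves_of_bruhatLE hlew ?_)
        rw [← hs.1.2]
        exact preserves_of_notMem hs.1.1 hjs
      · rcases Finset.subset_singleton_iff.1 hsub with h | h
        · have h' : f ⟨simpleReflection n j, hlew⟩ = f ⟨1, one_bruhatLE w⟩ := by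
            rw [h]
            exact (Finset.subset_empty.1 (hone ∅)).symm
          have := Subtype.ext_iff.1 (f.injective h')
          simp only at this
          rw [this] at hnp
          exact absurd (fun x => Iff.rfl) hnp
        · rw [← h, f.symm_apply_apply]
  choose g hg hgs using hatom
  have hinj : Function.Injective g := fun i i' h => by
    have : f.symm {i} = f.symm {i'} := Subtype.ext (by rw [hgs, hgs, h])
    simpa using this
  have h2 : k ≤ s.toFinset.card := by
    have := Finset.card_le_card (s := Finset.univ.image g) (t := s.toFinset)
      (fun j hj => by
        obtain ⟨i, -, rfl⟩ := Finset.mem_image.1 hj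
        exact List.mem_toFinset.2 (hg i))
    rwa [Finset.card_image_of_injective _ hinj, Finset.card_univ, Fintype.card_fin] at this
  rw [← Multiset.coe_nodup, ← Multiset.toFinset_card_eq_card_iff_nodup]
  exact le_antisymm s.toFinset_card_le (by simpa using h1.trans h2)

/-! ### Runs -/

theorem incRun_self (a : ℕ) : incRun a a = [a] := by
  simp [incRun]

theorem incRun_succ {a b : ℕ} (h : a ≤ b) : incRun a (b + 1) = incRun a b ++ [b + 1] := by
  rw [incRun, incRun, show b + 1 + 1 - a = (b + 1 - a) + 1 by omega, List.range'_concat]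
  congr 2; omega

theorem incRun_eq_cons {a b : ℕ} (h : a ≤ b) : ∃ t, incRun a b = a :: t := by
  rw [incRun, show b + 1 - a = (b - a) + 1 by omega, List.range'_succ]
  exact ⟨_, rfl⟩

theorem decRun_self (a : ℕ) : decRun a a = [a] := by
  simp [decRun, incRun_self]

theorem decRun_succ {a b : ℕ} (h : a ≤ b) : decRun a (b + 1) = (b + 1) :: decRun a b := by
  simp [decRun, incRun_succ h]

theorem decRun_eq_cons {a b : ℕ} (h : a ≤ b) : ∃ t, decRun a b = b :: t := by
  obtain rfl | ⟨c, rfl⟩ : a = b ∨ ∃ c, b = c + 1 := by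
    rcases b with _ | c
    · left; omega
    · right; exact ⟨c, rfl⟩
  · exact ⟨_, decRun_self a⟩
  · obtain rfl | h' := h.eq_or_lt
    · exact ⟨_, decRun_self _⟩
    · exact ⟨_, decRun_succ (by omega)⟩

theorem reverse_decRun (a b : ℕ) : (decRun a b).reverse = incRun a b := by
  simp [decRun]

theorem mem_incRun {a b x : ℕ} : x ∈ incRun a b ↔ a ≤ x ∧ x ≤ b := by
  simp only [incRun, List.mem_range'_1]; omega

theorem mem_decRun {a b x : ℕ} : x ∈ decRun a b ↔ a ≤ x ∧ x ≤ b := by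
  simp [decRun, mem_incRun]

theorem nodup_incRun (a b : ℕ) : (incRun a b).Nodup := List.nodup_range'

theorem nodup_decRun (a b : ℕ) : (decRun a b).Nodup := by
  simpa [decRun] using nodup_incRun a b

/-! ### Commuting a run to the end of a word -/

theorem simpleReflection_comm_wordProd {n i : ℕ} {s : List ℕ}
    (h : ∀ j ∈ s, i + 1 < j ∨ j + 1 < i) :
    wordProd n s * simpleReflection n i = simpleReflection n i * wordProd n s := by
  induction s with
  | nil => simp
  | cons j s ih =>
    rw [List.forall_mem_cons] at h
    rw [wordProd_cons, mul_assoc, ih h.2, ← mul_assoc, ← simpleReflection_comm h.1, mul_assoc]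

theorem sublist_pair_of_mem {x y : ℕ} {u v : List ℕ} (h : x ∈ u) : [x, y].Sublist (u ++ y :: v) :=
  (List.singleton_sublist.2 h).append (List.singleton_sublist.2 (by simp) : [y].Sublist (y :: v))

/-- In a word without repeated letters, `x` precedes `y` and `y` precedes `l` only if `x` precedes
`y :: l`. -/
theorem sublist_cons_cons {x y : ℕ} {l s : List ℕ} (hs : s.Nodup) (h1 : [x, y].Sublist s)
    (h2 : (y :: l).Sublist s) : (x :: y :: l).Sublist s := by
  induction s with
  | nil => simp at h1
  | cons z s ih =>
    rw [List.nodup_cons] at hs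
    have h2' : y ∈ s → (y :: l).Sublist s := fun hy => by
      cases h2 with
      | cons _ h => exact h
      | cons_cons _ h => exact absurd hy hs.1
    cases h1 with
    | cons _ h => exact (ih hs.2 h (h2' (h.subset (by simp)))).cons _
    | cons_cons _ h => exact (h2' (h.subset (by simp))).cons_cons _

/-- In a word without repeated letters and without letters below `a`, a decreasing run `b ⋯ a` that
`b + 1` does not precede can be commuted to the front: the letters in front of `b` commute with `b`,
and so on with `b - 1, …, a`. -/
theorem exists_decRun_mul (n : ℕ) {a b : ℕ} (hab : a ≤ b) {s : List ℕ} (hs : s.Nodup)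
    (ha : ∀ i ∈ s, a ≤ i) (hd : (decRun a b).Sublist s) (hb : ¬ [b + 1, b].Sublist s) :
    ∃ t, wordProd n s = wordProd n (decRun a b) * wordProd n t ∧ (decRun a b ++ t).Perm s := by
  induction b, hab using Nat.le_induction generalizing s with
  | base =>
    rw [decRun_self] at hd ⊢
    obtain ⟨u, v, rfl⟩ := List.append_of_mem (List.singleton_sublist.1 hd)
    have hu : ∀ j ∈ u, a + 1 < j ∨ j + 1 < a := by
      intro j hj
      left
      have h1 := ha j (by simp [hj])
      have h2 : j ≠ a := (List.nodup_append.1 hs).2.2 j hj a (by simp)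
      have h3 : j ≠ a + 1 := by rintro rfl; exact hb (sublist_pair_of_mem hj)
      omega
    refine ⟨u ++ v, ?_, by simpa using List.perm_middle.symm⟩
    rw [wordProd_append, wordProd_cons, wordProd_cons, wordProd_append, wordProd_nil, mul_one,
      ← mul_assoc, simpleReflection_comm_wordProd hu, mul_assoc]
  | succ b hab ih =>
    rw [decRun_succ hab] at hd ⊢
    obtain ⟨u, v, rfl⟩ := List.append_of_mem (hd.subset (by simp : b + 1 ∈ (b + 1) :: decRun a b))
    have hs' := List.nodup_append.1 hs
    have hbu : b + 1 ∉ u := fun h => hs'.2.2 _ h (b + 1) (by simp) rfl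
    have hbv : b + 1 ∉ v := (List.nodup_cons.1 hs'.2.1).1
    have hdv : (decRun a b).Sublist v := by
      clear ih ha hb hs hs'
      induction u with
      | nil => exact List.cons_sublist_cons.1 hd
      | cons z u ihu =>
        rw [List.mem_cons, not_or] at hbu
        refine ihu ?_ hbu.2
        cases hd with
        | cons _ h => exact h
        | cons_cons _ h => exact absurd rfl hbu.1
    have hbv' : b ∈ v := hdv.subset (mem_decRun.2 ⟨hab, le_rfl⟩)
    have hu : ∀ j ∈ u, b + 1 + 1 < j ∨ j + 1 < b + 1 := by
      intro j hj
      have h1 : j ≠ b + 1 := fun h => hbu (h ▸ hj)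
      have h2 : j ≠ b := hs'.2.2 j hj b (by simp [hbv'])
      have h3 : j ≠ b + 1 + 1 := by rintro rfl; exact hb (sublist_pair_of_mem hj)
      omega
    have hsub : (u ++ v).Sublist (u ++ (b + 1) :: v) :=
      (List.Sublist.refl u).append (List.sublist_cons_self _ _)
    obtain ⟨t, ht, hp⟩ := ih (hs.sublist hsub) (fun i hi => ha i (hsub.subset hi))
      (hdv.trans (List.sublist_append_right u v)) (fun h => by
        have := h.subset (by simp : b + 1 ∈ [b + 1, b])
        simp [hbu, hbv] at this)
    refine ⟨t, ?_, (hp.cons _).trans List.perm_middle.symm⟩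
    rw [wordProd_append, wordProd_cons, wordProd_cons, mul_assoc, ← ht, wordProd_append,
      ← mul_assoc, simpleReflection_comm_wordProd hu, mul_assoc]

theorem exists_mul_incRun (n : ℕ) {a b : ℕ} (hab : a ≤ b) {s : List ℕ} (hs : s.Nodup)
    (ha : ∀ i ∈ s, a ≤ i) (hd : (incRun a b).Sublist s) (hb : ¬ [b, b + 1].Sublist s) :
    ∃ t, wordProd n s = wordProd n t * wordProd n (incRun a b) ∧ (t ++ incRun a b).Perm s := by
  obtain ⟨t, ht, hp⟩ := exists_decRun_mul n hab (s := s.reverse) (by simpa using hs)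
    (by simpa using ha) (List.reverse_sublist.2 hd)
    (fun h => hb (by simpa using List.reverse_sublist.2 h))
  refine ⟨t.reverse, ?_, ?_⟩
  · have := congrArg (·⁻¹) ht
    simpa only [mul_inv_rev, ← wordProd_reverse, List.reverse_reverse, reverse_decRun] using this
  · have := (List.reverse_perm _).trans (hp.trans (List.reverse_perm s))
    simpa [reverse_decRun] using this

theorem not_sublist_of_isGreatest_dec {a b : ℕ} {s : List ℕ} (hs : s.Nodup)
    (hb : IsGreatest {c | a + 1 ≤ c ∧ (decRun a c).Sublist s} b) : ¬ [b + 1, b].Sublist s := by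
  intro h
  have hab : a ≤ b := by have := hb.1.1; omega
  have h2 := hb.1.2
  have : b + 1 ≤ b := by
    refine hb.2 ⟨by omega, ?_⟩
    rw [decRun_succ hab]
    obtain ⟨t, ht⟩ := decRun_eq_cons hab
    rw [ht] at h2 ⊢
    exact sublist_cons_cons hs h h2
  omega

theorem not_sublist_of_isGreatest_inc {a b : ℕ} {s : List ℕ} (hs : s.Nodup)
    (hb : IsGreatest {c | a + 1 ≤ c ∧ (incRun a c).Sublist s} b) : ¬ [b, b + 1].Sublist s := by
  intro h
  refine not_sublist_of_isGreatest_dec (a := a) (b := b) (s := s.reverse) (by simpa using hs) ?_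
    (by simpa using List.reverse_sublist.2 h)
  simpa [decRun] using hb

/-! ### Peelings -/

/-- `Peeling m w L`: the permutation `w` is built up from runs with letters greater than `m`, in
such a way that `L` are the runs of its canonical word. As compared with `IsCanonicalRuns`, no
reduced word is mentioned: the letters of a run form an interval `[a, b]`, and all further letters
are greater than `b`, and greater than `a + 1` if the run is the single letter `a`. -/
inductive Peeling {n : ℕ} : ℕ → Equiv.Perm (Fin n) → List (List ℕ) → Prop
  /-- The identity has no runs. -/
  | one (m : ℕ) : Peeling m 1 []
  /-- A decreasing run, possibly a single letter, is put on the left. -/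
  | dec {m a b : ℕ} {w : Equiv.Perm (Fin n)} {L : List (List ℕ)} (hma : m < a) (hab : a ≤ b)
      (hbn : b < n) (h : Peeling (max b (a + 1)) w L) :
      Peeling m (wordProd n (decRun a b) * w) (decRun a b :: L)
  /-- An increasing run with at least two letters is put on the right. -/
  | inc {m a b : ℕ} {w : Equiv.Perm (Fin n)} {L : List (List ℕ)} (hma : m < a) (hab : a < b)
      (hbn : b < n) (h : Peeling b w L) :
      Peeling m (w * wordProd n (incRun a b)) (L ++ [incRun a b])

theorem Peeling.flatten {n m : ℕ} {w : Equiv.Perm (Fin n)} {L : List (List ℕ)}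
    (h : Peeling m w L) :
    IsDecomposition w L.flatten ∧ L.flatten.Nodup ∧ ∀ i ∈ L.flatten, m < i := by
  induction h with
  | one m => exact ⟨⟨by simp, rfl⟩, by simp, by simp⟩
  | @dec m a b w L hma hab hbn _ ih =>
    obtain ⟨⟨h1, h2⟩, h3, h4⟩ := ih
    refine ⟨⟨?_, ?_⟩, ?_, ?_⟩
    · rw [List.flatten_cons, List.forall_mem_append]
      exact ⟨fun i hi => by rw [mem_decRun] at hi; omega, h1⟩
    · rw [List.flatten_cons, wordProd_append, h2]
    · rw [List.flatten_cons, List.nodup_append]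
      refine ⟨nodup_decRun a b, h3, fun i hi j hj => ?_⟩
      have := h4 j hj
      rw [mem_decRun] at hi
      omega
    · rw [List.flatten_cons, List.forall_mem_append]
      exact ⟨fun i hi => by rw [mem_decRun] at hi; omega,
        fun i hi => by have := h4 i hi; omega⟩
  | @inc m a b w L hma hab hbn _ ih =>
    obtain ⟨⟨h1, h2⟩, h3, h4⟩ := ih
    simp only [List.flatten_append, List.flatten_singleton]
    refine ⟨⟨?_, ?_⟩, ?_, ?_⟩
    · rw [List.forall_mem_append]
      exact ⟨h1, fun i hi => by rw [mem_incRun] at hi; omega⟩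
    · rw [wordProd_append, h2]
    · rw [List.nodup_append]
      refine ⟨h3, nodup_incRun a b, fun i hi j hj => ?_⟩
      have := h4 i hi
      rw [mem_incRun] at hj
      omega
    · rw [List.forall_mem_append]
      exact ⟨fun i hi => by have := h4 i hi; omega,
        fun i hi => by rw [mem_incRun] at hi; omega⟩

/-- Every outcome of the algorithm is a peeling, provided that some word of `w` has no repeated
letters. -/
theorem IsCanonicalRuns.peeling {n : ℕ} {w : Equiv.Perm (Fin n)} {L : List (List ℕ)}
    (h : IsCanonicalRuns w L) {m : ℕ} {s : List ℕ} (hs : IsDecomposition w s) (hn : s.Nodup)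
    (hm : ∀ i ∈ s, m < i) : Peeling m w L := by
  -- the data are first moved to the reduced word that the step under consideration uses
  have key : ∀ {w : Equiv.Perm (Fin n)} {s t : List ℕ} {m : ℕ}, IsDecomposition w s → s.Nodup →
      (∀ i ∈ s, m < i) → IsReducedWord w t →
      t.Nodup ∧ (∀ i ∈ t, 1 ≤ i ∧ i < n) ∧ wordProd n t = w ∧ ∀ i ∈ t, m < i := by
    intro w s t m hs hn hm ht
    obtain ⟨h1, h2⟩ := (isReducedWord_iff hs hn).1 ht
    refine ⟨h2, h1.1, h1.2, fun i hi => hm i ?_⟩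
    rw [mem_iff_not_preserves hs.1 hn, hs.2, ← h1.2, ← mem_iff_not_preserves h1.1 h2]
    exact hi
  -- a run that commutes to the front leaves a word of `w'` with letters greater than `b`
  have left : ∀ {w w' : Equiv.Perm (Fin n)} {t : List ℕ} {a b : ℕ}, a ≤ b → t.Nodup →
      (∀ i ∈ t, 1 ≤ i ∧ i < n) → wordProd n t = w → (∀ i ∈ t, a ≤ i) → (decRun a b).Sublist t →
      ¬ [b + 1, b].Sublist t → w = wordProd n (decRun a b) * w' →
      b < n ∧ ∃ t', IsDecomposition w' t' ∧ t'.Nodup ∧ (∀ i ∈ t', b < i) ∧ ∀ i ∈ t', i ∈ t := by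
    intro w w' t a b hab hn hv hw ha hd hb hw'
    obtain ⟨t', ht', hp⟩ := exists_decRun_mul n hab hn ha hd hb
    have hn' := List.nodup_append.1 (hp.nodup_iff.2 hn)
    have hmem : ∀ i ∈ t', i ∈ t := fun i hi => hp.subset (by simp [hi])
    refine ⟨(hv b (hd.subset (mem_decRun.2 ⟨hab, le_rfl⟩))).2, t',
      ⟨fun i hi => hv i (hmem i hi), ?_⟩, hn'.2.1, fun i hi => ?_, hmem⟩
    · rw [hw, hw'] at ht'
      exact (mul_left_cancel ht').symm
    · have h1 := ha i (hmem i hi)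
      by_contra h2
      exact hn'.2.2 i (mem_decRun.2 ⟨h1, by omega⟩) i hi rfl
  induction h generalizing m s with
  | one => exact .one m
  | @singleton w w' t a L ht hta hat hw _ ih =>
    obtain ⟨h1, h2, h3, h4⟩ := key hs hn hm ht
    rw [← decRun_self a] at hw ⊢
    obtain ⟨hbn, t', k1, k2, k3, k4⟩ := left le_rfl h1 h2 h3 (fun i hi => hta.2 hi)
      (by rw [decRun_self]; exact List.singleton_sublist.2 hta.1)
      (fun h => hat (h.subset (by simp))) hw
    rw [hw]
    refine .dec (h4 a hta.1) le_rfl hbn (ih k1 k2 fun i hi => ?_)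
    have h5 := k3 i hi
    have h6 : i ≠ a + 1 := fun h => hat (h ▸ k4 i hi)
    omega
  | @decreasing w w' t a b L ht hta hat hb hw _ ih =>
    obtain ⟨h1, h2, h3, h4⟩ := key hs hn hm ht
    have hab := hb.1.1
    obtain ⟨hbn, t', k1, k2, k3, k4⟩ := left (by omega) h1 h2 h3 (fun i hi => hta.2 hi) hb.1.2
      (not_sublist_of_isGreatest_dec h1 hb) hw
    rw [hw]
    exact .dec (h4 a hta.1) (by omega) hbn (ih k1 k2 fun i hi => by have := k3 i hi; omega)
  | @increasing w w' t a b L ht hta hat hb hw _ ih =>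
    obtain ⟨h1, h2, h3, h4⟩ := key hs hn hm ht
    have hab := hb.1.1
    obtain ⟨hbn, t', k1, k2, k3, k4⟩ := left (w := w⁻¹) (w' := w'⁻¹) (t := t.reverse) (a := a)
      (b := b) (by omega) (by simpa using h1) (by simpa using h2) (by rw [wordProd_reverse, h3])
      (fun i hi => hta.2 (List.mem_reverse.1 hi)) (List.reverse_sublist.2 hb.1.2)
      (fun h => not_sublist_of_isGreatest_inc h1 hb (by simpa using List.reverse_sublist.2 h))
      (by rw [hw, mul_inv_rev, ← wordProd_reverse, decRun])
    rw [hw]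
    refine .inc (h4 a hta.1) (by omega) hbn (ih (s := t'.reverse) ⟨by simpa using k1.1, ?_⟩
      (by simpa using k2) (by simpa using k3))
    rw [wordProd_reverse, k1.2, inv_inv]

theorem exists_isGreatest_run {a n : ℕ} {s : List ℕ} {r : ℕ → ℕ → List ℕ}
    (hr : ∀ c, a ≤ c → c ∈ r a c) (hs : ∀ i ∈ s, i < n) (h : (r a (a + 1)).Sublist s) :
    ∃ b, IsGreatest {c | a + 1 ≤ c ∧ (r a c).Sublist s} b := by
  have hbdd : BddAbove {c | a + 1 ≤ c ∧ (r a c).Sublist s} :=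
    ⟨n, fun c hc => (hs c (hc.2.subset (hr c (by have := hc.1; omega)))).le⟩
  have hne : {c | a + 1 ≤ c ∧ (r a c).Sublist s}.Nonempty := ⟨a + 1, le_rfl, h⟩
  exact ⟨_, Nat.sSup_mem hne hbdd, fun c hc => le_csSup hbdd hc⟩

theorem exists_isCanonicalRuns {n : ℕ} {w : Equiv.Perm (Fin n)} {s : List ℕ}
    (hs : IsDecomposition w s) (hn : s.Nodup) : ∃ L, IsCanonicalRuns w L := by
  induction hl : s.length using Nat.strong_induction_on generalizing s w with
  | _ l ih =>
  subst hl
  have hred := (isReducedWord_iff hs hn).2 ⟨hs, hn⟩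
  by_cases hne : s = []
  · exact ⟨[], by rw [← hs.2, hne]; exact .one⟩
  obtain ⟨a, ha⟩ : ∃ a, IsLeast {x | x ∈ s} a :=
    ⟨_, Nat.sInf_mem (s := {x | x ∈ s}) (List.exists_mem_of_ne_nil s hne),
      fun x hx => Nat.sInf_le hx⟩
  have hdec : ∀ b, a ≤ b → (decRun a b).Sublist s → ¬ [b + 1, b].Sublist s →
      ∃ w' L, w = wordProd n (decRun a b) * w' ∧ IsCanonicalRuns w' L := by
    intro b hab hd hb
    obtain ⟨t, ht, hp⟩ := exists_decRun_mul n hab hn (fun i hi => ha.2 hi) hd hb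
    obtain ⟨L, hL⟩ := ih t.length
      (by rw [← hp.length_eq]; simp [decRun, incRun]; omega) (w := wordProd n t) (s := t)
      ⟨fun i hi => hs.1 i (hp.subset (by simp [hi])), rfl⟩
      (List.nodup_append.1 (hp.nodup_iff.2 hn)).2.1 rfl
    exact ⟨_, L, by rw [← hs.2, ht], hL⟩
  by_cases hmem : a + 1 ∈ s
  · obtain ⟨u, v, rfl⟩ := List.append_of_mem ha.1
    rcases List.mem_append.1 hmem with h | h
    · have hsub : [a + 1, a].Sublist (u ++ a :: v) := sublist_pair_of_mem h
      obtain ⟨b, hb⟩ := exists_isGreatest_run (a := a) (r := decRun)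
        (fun c hc => mem_decRun.2 ⟨hc, le_rfl⟩) (fun i hi => (hs.1 i hi).2)
        (by rwa [decRun_succ le_rfl, decRun_self])
      obtain ⟨w', L, hw, hL⟩ := hdec b (by have := hb.1.1; omega) hb.1.2
        (not_sublist_of_isGreatest_dec hn hb)
      exact ⟨_, .decreasing hred ha hsub hb hw hL⟩
    · have h : a + 1 ∈ v := by simpa using h
      have hsub : [a, a + 1].Sublist (u ++ a :: v) :=
        ((List.singleton_sublist.2 h).cons_cons a).trans (List.sublist_append_right _ _)
      obtain ⟨b, hb⟩ := exists_isGreatest_run (a := a) (r := incRun)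
        (fun c hc => mem_incRun.2 ⟨hc, le_rfl⟩) (fun i hi => (hs.1 i hi).2)
        (by rwa [incRun_succ le_rfl, incRun_self])
      obtain ⟨t, ht, hp⟩ := exists_mul_incRun n (by have := hb.1.1; omega : a ≤ b) hn
        (fun i hi => ha.2 hi) hb.1.2 (not_sublist_of_isGreatest_inc hn hb)
      have hab := hb.1.1
      obtain ⟨L, hL⟩ := ih t.length
        (by rw [← hp.length_eq]; simp [incRun]; omega) (w := wordProd n t) (s := t)
        ⟨fun i hi => hs.1 i (hp.subset (by simp [hi])), rfl⟩
        (List.nodup_append.1 (hp.nodup_iff.2 hn)).1 rfl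
      exact ⟨_, .increasing hred ha hsub hb (by rw [← hs.2, ht]) hL⟩
  · obtain ⟨w', L, hw, hL⟩ := hdec a le_rfl
      (by rw [decRun_self]; exact List.singleton_sublist.2 ha.1)
      (fun h => hmem (h.subset (by simp)))
    rw [decRun_self] at hw
    exact ⟨_, .singleton hred ha hmem hw hL⟩

/-! ### One-line notation -/

/-- The entries `w(1), …, w(n)` of the one-line notation of `w`, as a function on the natural
numbers: `w` acts on `{1, …, n}` and all other numbers are fixed. -/
def oneLine {n : ℕ} (w : Equiv.Perm (Fin n)) (j : ℕ) : ℕ :=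
  if h : 1 ≤ j ∧ j ≤ n then w ⟨j - 1, by omega⟩ + 1 else j

@[simp] theorem oneLine_one {n : ℕ} (j : ℕ) : oneLine (1 : Equiv.Perm (Fin n)) j = j := by
  unfold oneLine
  split_ifs <;> simp; omega

theorem oneLine_mul {n : ℕ} (u v : Equiv.Perm (Fin n)) (j : ℕ) :
    oneLine (u * v) j = oneLine u (oneLine v j) := by
  by_cases h : 1 ≤ j ∧ j ≤ n
  · have h' : 1 ≤ (v ⟨j - 1, by omega⟩ : ℕ) + 1 ∧ (v ⟨j - 1, by omega⟩ : ℕ) + 1 ≤ n := by omega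
    simp [oneLine, dif_pos h]
  · simp [oneLine, dif_neg h]

theorem oneLine_injective {n : ℕ} (w : Equiv.Perm (Fin n)) : Function.Injective (oneLine w) := by
  refine Function.LeftInverse.injective (g := oneLine w⁻¹) fun j => ?_
  rw [← oneLine_mul, inv_mul_cancel, oneLine_one]

theorem oneLine_simpleReflection {n i : ℕ} (hi : 1 ≤ i ∧ i < n) (j : ℕ) :
    oneLine (simpleReflection n i) j = if j = i then i + 1 else if j = i + 1 then i else j := by
  unfold oneLine
  split_ifs with h <;> first | rw [val_simpleReflection hi]; simp only; split_ifs <;> omega | omega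

theorem oneLine_decRun {n a b : ℕ} (ha : 1 ≤ a) (hab : a ≤ b) (hb : b < n) (j : ℕ) :
    oneLine (wordProd n (decRun a b)) j =
      if j = a then b + 1 else if a < j ∧ j ≤ b + 1 then j - 1 else j := by
  induction b, hab using Nat.le_induction with
  | base =>
    rw [decRun_self, wordProd_cons, wordProd_nil, mul_one, oneLine_simpleReflection ⟨ha, hb⟩]
    split_ifs <;> omega
  | succ b hab ih =>
    rw [decRun_succ hab, wordProd_cons, oneLine_mul, ih (by omega),
      oneLine_simpleReflection ⟨by omega, hb⟩]
    split_ifs <;> omega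

theorem oneLine_incRun {n a b : ℕ} (ha : 1 ≤ a) (hab : a ≤ b) (hb : b < n) (j : ℕ) :
    oneLine (wordProd n (incRun a b)) j =
      if j = b + 1 then a else if a ≤ j ∧ j ≤ b then j + 1 else j := by
  rw [← reverse_decRun, wordProd_reverse]
  apply oneLine_injective (wordProd n (decRun a b))
  rw [← oneLine_mul, mul_inv_cancel, oneLine_one, oneLine_decRun ha hab hb]
  split_ifs <;> omega

/-! ### Uniqueness of the runs -/

theorem Peeling.oneLine_of_le {n m : ℕ} {w : Equiv.Perm (Fin n)} {L : List (List ℕ)}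
    (h : Peeling m w L) {j : ℕ} (hj : j ≤ m) : oneLine w j = j := by
  induction h with
  | one m => simp
  | dec hma hab hbn _ ih =>
    rw [oneLine_mul, ih (by omega), oneLine_decRun (by omega) hab hbn]
    split_ifs <;> omega
  | inc hma hab hbn _ ih =>
    rw [oneLine_mul, oneLine_incRun (by omega) hab.le hbn, if_neg (by omega), if_neg (by omega),
      ih (by omega)]

theorem Peeling.lt_oneLine {n m : ℕ} {w : Equiv.Perm (Fin n)} {L : List (List ℕ)}
    (h : Peeling m w L) {j : ℕ} (hj : m < j) : m < oneLine w j := by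
  by_contra hle
  have := oneLine_injective w (h.oneLine_of_le (not_lt.1 hle))
  omega

/-- The last rule of a peeling, with the values of `w` that determine the rule and its run: `a` is
the least number that `w` moves, `b` can be read off from `w(a)` or from the preimage of `a`, and
the rule from this preimage being `a + 1` or not. -/
theorem Peeling.cases_oneLine {n m : ℕ} {w : Equiv.Perm (Fin n)} {L : List (List ℕ)}
    (h : Peeling m w L) :
    (w = 1 ∧ L = []) ∨
    (∃ a b w' L', a ≤ b ∧ w = wordProd n (decRun a b) * w' ∧ L = decRun a b :: L' ∧
      Peeling (max b (a + 1)) w' L' ∧ (∀ j < a, oneLine w j = j) ∧ oneLine w a = b + 1 ∧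
      oneLine w (a + 1) = a) ∨
    (∃ a b w' L', a < b ∧ w = w' * wordProd n (incRun a b) ∧ L = L' ++ [incRun a b] ∧
      Peeling b w' L' ∧ (∀ j < a, oneLine w j = j) ∧ oneLine w (b + 1) = a) := by
  cases h with
  | one => exact .inl ⟨rfl, rfl⟩
  | @dec m a b w L hma hab hbn h =>
    have hfix : ∀ j ≤ a + 1, oneLine w j = j := fun j hj => h.oneLine_of_le (by omega)
    refine .inr (.inl ⟨a, b, w, L, hab, rfl, rfl, h, fun j hj => ?_, ?_, ?_⟩)
    all_goals
      rw [oneLine_mul, hfix _ (by omega), oneLine_decRun (by omega) hab hbn]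
      split_ifs <;> omega
  | @inc m a b w L hma hab hbn h =>
    refine .inr (.inr ⟨a, b, w, L, hab, rfl, rfl, h, fun j hj => ?_, ?_⟩)
    · rw [oneLine_mul, oneLine_incRun (by omega) hab.le hbn, if_neg (by omega),
        if_neg (by omega), h.oneLine_of_le (by omega)]
    · rw [oneLine_mul, oneLine_incRun (by omega) hab.le hbn, if_pos rfl, h.oneLine_of_le hab.le]

theorem Peeling.unique {n m m' : ℕ} {w : Equiv.Perm (Fin n)} {L L' : List (List ℕ)}
    (h : Peeling m w L) (h' : Peeling m' w L') : L = L' := by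
  induction hl : L.length using Nat.strong_induction_on generalizing m m' w L L' with
  | _ l ih =>
  subst hl
  have hinj := oneLine_injective w
  rcases h.cases_oneLine with ⟨hw, hL⟩ | ⟨a, b, v, K, hab, hw, hL, hv, h1, h2, h3⟩ |
      ⟨a, b, v, K, hab, hw, hL, hv, h1, h2⟩ <;>
    rcases h'.cases_oneLine with ⟨hw', hL'⟩ | ⟨a', b', v', K', hab', hw', hL', hv', h1', h2', h3'⟩ |
      ⟨a', b', v', K', hab', hw', hL', hv', h1', h2'⟩
  · rw [hL, hL']
  · rw [hw, oneLine_one] at h2'; omega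
  · rw [hw, oneLine_one] at h2'; omega
  · rw [hw', oneLine_one] at h2; omega
  · obtain rfl : a = a' := by
      rcases lt_trichotomy a a' with h | h | h
      · have := h1' a h; omega
      · exact h
      · have := h1 a' h; omega
    obtain rfl : b = b' := by omega
    rw [hw, mul_right_inj] at hw'
    subst hw'
    rw [hL, hL', ih K.length (by rw [hL]; simp) hv hv' rfl]
  · exfalso
    rcases lt_trichotomy a a' with h | rfl | h
    · have := h1' a h; omega
    · have := hinj (h3.trans h2'.symm); omega
    · have := hinj ((h1 a' h).trans h2'.symm); omega
  · rw [hw', oneLine_one] at h2; omega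
  · exfalso
    rcases lt_trichotomy a a' with h | rfl | h
    · have := hinj ((h1' a h).trans h2.symm); omega
    · have := hinj (h3'.trans h2.symm); omega
    · have := h1 a' h; omega
  · obtain rfl : a = a' := by
      rcases lt_trichotomy a a' with h | h | h
      · have := hinj ((h1' a h).trans h2.symm); omega
      · exact h
      · have := hinj ((h1 a' h).trans h2'.symm); omega
    obtain rfl : b = b' := by have := hinj (h2.trans h2'.symm); omega
    rw [hw, mul_left_inj] at hw'
    subst hw'
    rw [hL, hL', ih K.length (by rw [hL]; simp) hv hv' rfl]

/-! ### Insertion into the first row -/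

theorem insertRow_append_left {x : ℕ} {p : List ℕ} (hp : ∀ y ∈ p, y ≤ x) (r : List ℕ) :
    insertRow x (p ++ r) = (p ++ (insertRow x r).1, (insertRow x r).2) := by
  induction p with
  | nil => rfl
  | cons y p ih =>
    rw [List.forall_mem_cons] at hp
    rw [List.cons_append, insertRow, if_neg (by omega), ih hp.2]
    rfl

theorem insertRow_of_forall_le {x : ℕ} {r : List ℕ} (hr : ∀ y ∈ r, y ≤ x) :
    insertRow x r = (r ++ [x], none) := by
  have := insertRow_append_left hr []
  rwa [List.append_nil] at this

theorem insertRow_perm (x : ℕ) (r : List ℕ) :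
    ((insertRow x r).1 ++ (insertRow x r).2.toList).Perm (x :: r) := by
  induction r with
  | nil => simp [insertRow]
  | cons y r ih =>
    rw [insertRow]
    split_ifs
    · simp
    · exact (ih.cons y).trans (List.Perm.swap x y r)

theorem lt_of_mem_insertRow {x y : ℕ} {r : List ℕ} (h : y ∈ (insertRow x r).2) : x < y := by
  induction r with
  | nil => simp [insertRow] at h
  | cons z r ih =>
    rw [insertRow] at h
    split_ifs at h with hz
    · simp at h; omega
    · exact ih h

theorem insertRow_map {φ : ℕ → ℕ} {S : Set ℕ} (hφ : StrictMonoOn φ S) {x : ℕ} (hx : x ∈ S)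
    {r : List ℕ} (hr : ∀ y ∈ r, y ∈ S) :
    insertRow (φ x) (r.map φ) = ((insertRow x r).1.map φ, (insertRow x r).2.map φ) := by
  induction r with
  | nil => rfl
  | cons y r ih =>
    rw [List.forall_mem_cons] at hr
    have hlt := hφ.lt_iff_lt hx hr.1
    rw [List.map_cons, insertRow, insertRow, ih hr.2]
    by_cases h : x < y
    · rw [if_pos h, if_pos (hlt.2 h)]; rfl
    · rw [if_neg h, if_neg (mt hlt.1 h)]; rfl

theorem mem_of_mem_insertRow {x y : ℕ} {r : List ℕ} (h : y ∈ (insertRow x r).1) :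
    y = x ∨ y ∈ r := by
  simpa using (insertRow_perm x r).subset (List.mem_append_left _ h)

/-- Insert the first components of the pairs in `l` into the row `r`, one after the other. The
result is the list of the entries that are bumped, each with the second component of the pair
whose insertion bumps it. -/
def bumps : List ℕ → List (ℕ × ℕ) → List (ℕ × ℕ)
  | _, [] => []
  | r, p :: l => ((insertRow p.1 r).2.toList.map (·, p.2)) ++ bumps (insertRow p.1 r).1 l

theorem bumps_append_left {p : List ℕ} {l : List (ℕ × ℕ)} (h : ∀ y ∈ p, ∀ q ∈ l, y ≤ q.1)
    (r : List ℕ) : bumps (p ++ r) l = bumps r l := by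
  induction l generalizing r with
  | nil => rfl
  | cons q l ih =>
    rw [bumps, bumps, insertRow_append_left fun y hy => h y hy q (by simp)]
    rw [ih fun y hy q hq => h y hy q (by simp [hq])]

theorem bumps_of_pairwise {r : List ℕ} {s l : List (ℕ × ℕ)}
    (h : (r ++ s.map Prod.fst).Pairwise (· ≤ ·)) :
    bumps r (s ++ l) = bumps (r ++ s.map Prod.fst) l := by
  induction s generalizing r with
  | nil => simp
  | cons q s ih =>
    have hr : insertRow q.1 r = (r ++ [q.1], none) := insertRow_of_forall_le fun y hy =>
      (List.pairwise_append.1 h).2.2 y hy q.1 (by simp)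
    rw [List.cons_append, bumps, hr]
    simpa using ih (r := r ++ [q.1]) (by simpa using h)

theorem bumps_nil_of_pairwise {s l : List (ℕ × ℕ)} (hs : (s.map Prod.fst).Pairwise (· ≤ ·))
    (h : ∀ p ∈ s, ∀ q ∈ l, p.1 ≤ q.1) : bumps [] (s ++ l) = bumps [] l := by
  rw [bumps_of_pairwise (by simpa using hs), List.nil_append, ← List.append_nil (s.map _),
    bumps_append_left]
  intro y hy q hq
  obtain ⟨p, hp, rfl⟩ := List.mem_map.1 hy
  exact h p hp q hq

theorem bumps_map {φ : ℕ → ℕ} {S : Set ℕ} (hφ : StrictMonoOn φ S) {r : List ℕ}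
    (hr : ∀ y ∈ r, y ∈ S) {l : List (ℕ × ℕ)} (hl : ∀ p ∈ l, p.1 ∈ S) :
    bumps (r.map φ) (l.map fun p => (φ p.1, p.2)) = (bumps r l).map fun p => (φ p.1, p.2) := by
  induction l generalizing r with
  | nil => rfl
  | cons q l ih =>
    rw [List.forall_mem_cons] at hl
    have hr' : ∀ y ∈ (insertRow q.1 r).1, y ∈ S := fun y hy => by
      rcases mem_of_mem_insertRow hy with rfl | h
      exacts [hl.1, hr y h]
    rw [List.map_cons, bumps, bumps, insertRow_map hφ hl.1 hr, ih hr' hl.2, List.map_append]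
    congr 1
    cases (insertRow q.1 r).2 <;> rfl

theorem exists_lt_of_mem_bumps {r : List ℕ} {l : List (ℕ × ℕ)} {p : ℕ × ℕ} (h : p ∈ bumps r l) :
    ∃ q ∈ l, q.1 < p.1 := by
  induction l generalizing r with
  | nil => simp [bumps] at h
  | cons q l ih =>
    rw [bumps, List.mem_append] at h
    rcases h with h | h
    · obtain ⟨y, hy, rfl⟩ := List.mem_map.1 h
      exact ⟨q, by simp, lt_of_mem_insertRow (by simpa using hy)⟩
    · obtain ⟨q', hq', hlt⟩ := ih h
      exact ⟨q', by simp [hq'], hlt⟩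

/-! ### The bumped entries of a boolean permutation -/

/-- The part `w(m + 1) ⋯ w(n)` of the one-line notation, each entry paired with its position. -/
def oneLineFrom {n : ℕ} (w : Equiv.Perm (Fin n)) (m : ℕ) : List (ℕ × ℕ) :=
  (List.range' (m + 1) (n - m)).map fun j => (oneLine w j, j)

theorem pairwise_map_range' {f : ℕ → ℕ × ℕ} {s k : ℕ}
    (hf : ∀ i j, s ≤ i → i < j → j < s + k → (f i).1 ≤ (f j).1) :
    (((List.range' s k).map f).map Prod.fst).Pairwise (· ≤ ·) := by
  rw [List.map_map, List.pairwise_map]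
  refine (List.pairwise_lt_range' (s := s) (n := k)).imp_of_mem fun {i j} hi hj hij => ?_
  rw [List.mem_range'_1] at hi hj
  exact hf i j hi.1 hij hj.2

theorem range'_split {a b k : ℕ} (h : a ≤ b) (h' : b ≤ a + k) :
    List.range' a k = List.range' a (b - a) ++ List.range' b (k - (b - a)) := by
  obtain ⟨d, rfl⟩ := Nat.exists_eq_add_of_le h
  rw [Nat.add_sub_cancel_left, List.range'_append_1, Nat.add_sub_cancel' (by omega)]

theorem range'_eq_cons {a k : ℕ} (h : 0 < k) :
    List.range' a k = a :: List.range' (a + 1) (k - 1) := by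
  obtain ⟨k, rfl⟩ := Nat.exists_eq_succ_of_ne_zero h.ne'
  exact List.range'_succ

theorem bumps_oneLineFrom_one {n : ℕ} (m : ℕ) :
    bumps [] (oneLineFrom (1 : Equiv.Perm (Fin n)) m) = [] := by
  rw [← List.append_nil (oneLineFrom _ m), bumps_nil_of_pairwise _ (by simp)]
  · rfl
  · exact pairwise_map_range' fun i j _ h _ => by simpa using h.le

theorem Peeling.lt_of_mem_oneLineFrom {n m : ℕ} {w : Equiv.Perm (Fin n)} {L : List (List ℕ)}
    (h : Peeling m w L) {p : ℕ × ℕ} (hp : p ∈ oneLineFrom w m) : m < p.1 := by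
  obtain ⟨j, hj, rfl⟩ := List.mem_map.1 hp
  rw [List.mem_range'_1] at hj
  exact h.lt_oneLine (by omega)

/-- In the one-line notation of `s_b ⋯ s_a w'`, the entry `b + 1` at position `a` is bumped by the
entry `a` at position `a + 1`. Apart from this, only entries that are at most all later ones and the
relabelling `b + 1 ↦ b` of the least entry (void for `a = b`) distinguish the sequence from the one
of `w'`. -/
theorem bumps_decRun_mul {n m a b : ℕ} {w : Equiv.Perm (Fin n)} {L : List (List ℕ)} (hma : m < a)
    (hab : a ≤ b) (hbn : b < n) (h : Peeling (max b (a + 1)) w L) :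
    bumps [] (oneLineFrom (wordProd n (decRun a b) * w) m) =
      (b + 1, a + 1) :: bumps [] (oneLineFrom w (max b (a + 1))) := by
  obtain ⟨c, hc⟩ : ∃ c, c = max b (a + 1) := ⟨_, rfl⟩
  rw [← hc] at h ⊢
  let φ : ℕ → ℕ := fun x => if x = b + 1 then b else x
  have hD := oneLine_decRun (show 1 ≤ a by omega) hab hbn
  have hrange : List.range' (m + 1) (n - m) = List.range' (m + 1) (a - (m + 1)) ++
      a :: (a + 1) :: (List.range' (a + 2) (c - (a + 1)) ++ List.range' (c + 1) (n - c)) := by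
    rw [range'_split (b := a) (by omega) (by omega), range'_eq_cons (a := a) (by omega),
      range'_eq_cons (a := a + 1) (by omega), range'_split (a := a + 1 + 1) (b := c + 1)
        (by omega) (by omega)]
    congr 5 <;> omega
  have hsplit : oneLineFrom (wordProd n (decRun a b) * w) m =
      (List.range' (m + 1) (a - (m + 1))).map (fun j => (j, j)) ++
      (b + 1, a) :: (a, a + 1) :: ((List.range' (a + 2) (c - (a + 1))).map (fun j => (j - 1, j)) ++
        (oneLineFrom w c).map fun p => (φ p.1, p.2)) := by
    rw [oneLineFrom, hrange, List.map_append, List.map_cons, List.map_cons, List.map_append,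
      oneLineFrom, List.map_map]
    have hfix : ∀ j ≤ c, oneLine w j = j := fun j hj => h.oneLine_of_le hj
    congr 1
    · refine List.map_congr_left fun j hj => ?_
      rw [List.mem_range'_1] at hj
      rw [oneLine_mul, hfix j (by omega), hD, if_neg (by omega), if_neg (by omega)]
    · rw [oneLine_mul, oneLine_mul, hfix a (by omega), hfix (a + 1) (by omega), hD, hD,
        if_pos rfl, if_neg (by omega), if_pos (by omega)]
      congr 3
      · refine List.map_congr_left fun j hj => ?_
        rw [List.mem_range'_1] at hj
        rw [oneLine_mul, hfix j (by omega), hD, if_neg (by omega), if_pos (by omega)]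
      · refine List.map_congr_left fun j hj => ?_
        rw [List.mem_range'_1] at hj
        have := h.lt_oneLine (j := j) (by omega)
        simp only [oneLine_mul, hD, Function.comp, φ]
        congr 1
        split_ifs <;> omega
  have hφ : StrictMonoOn φ {x | c < x} := by
    intro x hx y hy hxy
    simp only [φ, Set.mem_ofPred_eq] at *
    split_ifs <;> omega
  have hφ' : ∀ q ∈ (oneLineFrom w c).map (fun p => (φ p.1, p.2)), b ≤ q.1 ∧ a < q.1 := by
    intro q hq
    obtain ⟨p, hp, rfl⟩ := List.mem_map.1 hq
    have := h.lt_of_mem_oneLineFrom hp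
    simp only [φ]
    split_ifs <;> omega
  rw [hsplit, bumps_nil_of_pairwise]
  · rw [bumps, bumps]
    simp only [insertRow, Option.toList_none, List.map_nil, List.nil_append,
      if_pos (show a < b + 1 by omega), Option.toList_some, List.map_cons, List.singleton_append]
    congr 1
    rw [bumps_of_pairwise, ← List.append_nil (_ ++ List.map Prod.fst _), bumps_append_left]
    · refine (bumps_map hφ (r := []) (by simp) fun p hp => h.lt_of_mem_oneLineFrom hp).trans ?_
      -- a bumped entry exceeds an inserted one, so it is not the least entry `b + 1`
      refine (List.map_congr_left fun p hp => ?_).trans (List.map_id _)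
      obtain ⟨q, hq, hlt⟩ := exists_lt_of_mem_bumps hp
      have := h.lt_of_mem_oneLineFrom hq
      simp only [φ, if_neg (show p.1 ≠ b + 1 by omega), id]
    · intro y hy q hq
      have := hφ' q hq
      simp only [List.singleton_append, List.mem_cons, List.map_map, List.mem_map,
        List.mem_range'_1, Function.comp] at hy
      rcases hy with rfl | ⟨j, hj, rfl⟩ <;> omega
    · rw [List.singleton_append, List.pairwise_cons]
      refine ⟨fun y hy => ?_, pairwise_map_range' fun i j _ _ _ => by simp only; omega⟩
      simp only [List.map_map, List.mem_map, List.mem_range'_1, Function.comp] at hy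
      obtain ⟨j, hj, rfl⟩ := hy
      omega
  · exact pairwise_map_range' fun i j _ _ _ => by simp only; omega
  · intro p hp q hq
    obtain ⟨j, hj, rfl⟩ := List.mem_map.1 hp
    rw [List.mem_range'_1] at hj
    rw [List.mem_cons, List.mem_cons, List.mem_append] at hq
    rcases hq with rfl | rfl | hq | hq
    · simp only; omega
    · simp only; omega
    · obtain ⟨i, hi, rfl⟩ := List.mem_map.1 hq
      rw [List.mem_range'_1] at hi
      simp only; omega
    · have := hφ' q hq
      simp only; omega

/-- In the one-line notation of `w' s_a ⋯ s_b`, the entry `a + 1` at position `a` is bumped by the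
entry `a` at position `b + 1`. Apart from this, only entries that are less than all later ones
distinguish the sequence from the one of `w'`. -/
theorem bumps_mul_incRun {n m a b : ℕ} {w : Equiv.Perm (Fin n)} {L : List (List ℕ)} (hma : m < a)
    (hab : a < b) (hbn : b < n) (h : Peeling b w L) :
    bumps [] (oneLineFrom (w * wordProd n (incRun a b)) m) =
      (a + 1, b + 1) :: bumps [] (oneLineFrom w b) := by
  have hI := oneLine_incRun (show 1 ≤ a by omega) hab.le hbn
  have hrange : List.range' (m + 1) (n - m) = List.range' (m + 1) (a - (m + 1)) ++
      (a :: (List.range' (a + 1) (b - (a + 1)) ++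
        b :: (b + 1) :: List.range' (b + 2) (n - (b + 1)))) := by
    rw [range'_split (b := a) (by omega) (by omega), range'_eq_cons (a := a) (by omega),
      range'_split (a := a + 1) (b := b) (by omega) (by omega), range'_eq_cons (a := b) (by omega),
      range'_eq_cons (a := b + 1) (by omega)]
    congr 6; omega
  have hfix : ∀ j ≤ b, oneLine w j = j := fun j hj => h.oneLine_of_le hj
  obtain ⟨l, hl⟩ : ∃ l, l = (List.range' (b + 2) (n - (b + 1))).map fun j => (oneLine w j, j) :=
    ⟨_, rfl⟩
  have hw : oneLineFrom w b = (oneLine w (b + 1), b + 1) :: l := by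
    rw [oneLineFrom, show n - b = n - (b + 1) + 1 by omega, List.range'_succ, List.map_cons, hl]
  have hsplit : oneLineFrom (w * wordProd n (incRun a b)) m =
      (List.range' (m + 1) (a - (m + 1))).map (fun j => (j, j)) ++
      (((a + 1, a) :: (List.range' (a + 1) (b - (a + 1))).map (fun j => (j + 1, j)) ++
        [(oneLine w (b + 1), b)]) ++ (a, b + 1) :: l) := by
    rw [oneLineFrom, hrange, List.map_append, List.map_cons, List.map_append, List.map_cons,
      List.map_cons, List.append_assoc, List.cons_append]
    congr 1
    · refine List.map_congr_left fun j hj => ?_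
      rw [List.mem_range'_1] at hj
      rw [oneLine_mul, hI, if_neg (by omega), if_neg (by omega), hfix j (by omega)]
    · rw [oneLine_mul, hI, if_neg (by omega), if_pos (by omega), hfix (a + 1) (by omega)]
      congr 2
      · refine List.map_congr_left fun j hj => ?_
        rw [List.mem_range'_1] at hj
        rw [oneLine_mul, hI, if_neg (by omega), if_pos (by omega), hfix (j + 1) (by omega)]
      · rw [oneLine_mul, oneLine_mul, hI, hI, if_neg (by omega), if_pos (by omega), if_pos rfl,
          hfix a (by omega), List.singleton_append, hl]
        congr 2
        refine List.map_congr_left fun j hj => ?_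
        rw [List.mem_range'_1] at hj
        rw [oneLine_mul, hI, if_neg (by omega), if_neg (by omega)]
  have hlt : ∀ q ∈ l, b < q.1 := fun q hq => h.lt_of_mem_oneLineFrom (by rw [hw]; simp [hq])
  have hb1 := h.lt_oneLine (j := b + 1) (by omega)
  rw [hsplit, bumps_nil_of_pairwise]
  · rw [bumps_of_pairwise, hw]
    · simp only [List.nil_append, List.map_append, List.map_cons, List.map_nil, List.cons_append,
        bumps, insertRow, if_pos (show a < a + 1 by omega), Option.toList_some, Option.toList_none]
      congr 1
      rw [← List.cons_append, bumps_append_left]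
      intro y hy q hq
      have := hlt q hq
      simp only [List.mem_cons, List.map_map, List.mem_map, List.mem_range'_1,
        Function.comp] at hy
      rcases hy with rfl | ⟨j, hj, rfl⟩ <;> omega
    · rw [List.nil_append, List.cons_append, List.map_cons, List.map_append, List.map_cons,
        List.map_nil, List.pairwise_cons, List.pairwise_append]
      refine ⟨fun y hy => ?_, pairwise_map_range' fun i j _ _ _ => by simp only; omega, by simp,
        fun y hy z hz => ?_⟩
      · simp only [List.mem_append, List.mem_singleton, List.map_map, List.mem_map,
          List.mem_range'_1, Function.comp] at hy
        rcases hy with ⟨j, hj, rfl⟩ | rfl <;> omega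
      · simp only [List.mem_singleton, List.map_map, List.mem_map,
          List.mem_range'_1, Function.comp] at hy hz
        obtain ⟨j, hj, rfl⟩ := hy
        omega
  · exact pairwise_map_range' fun i j _ _ _ => by simp only; omega
  · intro p hp q hq
    obtain ⟨j, hj, rfl⟩ := List.mem_map.1 hp
    rw [List.mem_range'_1] at hj
    simp only [List.mem_append, List.mem_cons, List.mem_map, List.mem_range'_1,
      List.not_mem_nil, or_false] at hq
    rcases hq with ((rfl | ⟨i, hi, rfl⟩) | rfl) | rfl | hq
    · simp only; omega
    · simp only; omega
    · simp only; omega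
    · simp only; omega
    · have := hlt q hq
      simp only; omega

theorem leftmostSucc_cons (r : List ℕ) (L : List (List ℕ)) :
    leftmostSucc (r :: L) = {m | ∃ i, r.head? = some i ∧ m = i + 1} ∪ leftmostSucc L := by
  ext m; simp [leftmostSucc]

theorem rightmostSucc_cons (r : List ℕ) (L : List (List ℕ)) :
    rightmostSucc (r :: L) = {m | ∃ i, r.getLast? = some i ∧ m = i + 1} ∪ rightmostSucc L := by
  ext m; simp [rightmostSucc]

theorem leftmostSucc_concat (r : List ℕ) (L : List (List ℕ)) :
    leftmostSucc (L ++ [r]) = leftmostSucc (r :: L) := by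
  ext m; simp [leftmostSucc, or_comm]

theorem rightmostSucc_concat (r : List ℕ) (L : List (List ℕ)) :
    rightmostSucc (L ++ [r]) = rightmostSucc (r :: L) := by
  ext m; simp [rightmostSucc, or_comm]

theorem head?_incRun {a b : ℕ} (h : a ≤ b) : (incRun a b).head? = some a := by
  obtain ⟨t, ht⟩ := incRun_eq_cons h
  rw [ht]; rfl

theorem head?_decRun {a b : ℕ} (h : a ≤ b) : (decRun a b).head? = some b := by
  obtain ⟨t, ht⟩ := decRun_eq_cons h
  rw [ht]; rfl

/-- The entries bumped out of the first row form an increasing sequence; they are the successors of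
the leftmost entries of the runs, and they are bumped at the successors of the rightmost ones. -/
theorem Peeling.bumps_oneLineFrom {n m : ℕ} {w : Equiv.Perm (Fin n)} {L : List (List ℕ)}
    (h : Peeling m w L) :
    ((bumps [] (oneLineFrom w m)).map Prod.fst).Pairwise (· < ·) ∧
    {x | x ∈ (bumps [] (oneLineFrom w m)).map Prod.fst} = leftmostSucc L ∧
    {x | x ∈ (bumps [] (oneLineFrom w m)).map Prod.snd} = rightmostSucc L := by
  have hlt : ∀ {m w L}, Peeling (n := n) m w L →
      ∀ x ∈ (bumps [] (oneLineFrom w m)).map Prod.fst, m + 1 < x := by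
    intro m w L h x hx
    obtain ⟨p, hp, rfl⟩ := List.mem_map.1 hx
    obtain ⟨q, hq, hqp⟩ := exists_lt_of_mem_bumps hp
    have := h.lt_of_mem_oneLineFrom hq
    omega
  induction h with
  | one m => simp [bumps_oneLineFrom_one, leftmostSucc, rightmostSucc]
  | dec hma hab hbn h ih =>
    rw [bumps_decRun_mul hma hab hbn h, leftmostSucc_cons, rightmostSucc_cons, ← ih.2.1, ← ih.2.2,
      head?_decRun hab, decRun, List.getLast?_reverse, head?_incRun hab]
    refine ⟨List.pairwise_cons.2 ⟨fun x hx => ?_, ih.1⟩, ?_, ?_⟩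
    · have := hlt h x hx
      simp only; omega
    · ext x; simp
    · ext x; simp
  | inc hma hab hbn h ih =>
    rw [bumps_mul_incRun hma hab hbn h, leftmostSucc_concat, rightmostSucc_concat,
      leftmostSucc_cons, rightmostSucc_cons, ← ih.2.1, ← ih.2.2, head?_incRun hab.le,
      ← reverse_decRun, List.getLast?_reverse, head?_decRun hab.le]
    refine ⟨List.pairwise_cons.2 ⟨fun x hx => ?_, ih.1⟩, ?_, ?_⟩
    · have := hlt h x hx
      simp only; omega
    · ext x; simp
    · ext x; simp

/-! ### Tableaux with at most two rows -/

/-- The tableau with first row `r` and second row `s`, where empty rows are left out. -/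
def twoRows : List ℕ → List ℕ → List (List ℕ)
  | [], _ => []
  | x :: r, [] => [x :: r]
  | x :: r, y :: s => [x :: r, y :: s]

theorem length_twoRows_le (r s : List ℕ) : (twoRows r s).length ≤ 2 := by
  rcases r with _ | ⟨x, r⟩ <;> rcases s with _ | ⟨y, s⟩ <;> simp [twoRows]

theorem rowContents_twoRows_zero (r s : List ℕ) : rowContents (twoRows r s) 0 = {x | x ∈ r} := by
  rcases r with _ | ⟨x, r⟩ <;> rcases s with _ | ⟨y, s⟩ <;> simp [twoRows, rowContents]

theorem rowContents_twoRows_one {r s : List ℕ} (h : r = [] → s = []) :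
    rowContents (twoRows r s) 1 = {x | x ∈ s} := by
  rcases r with _ | ⟨x, r⟩ <;> rcases s with _ | ⟨y, s⟩ <;> simp_all [twoRows, rowContents]

theorem insertRow_ne_nil (x : ℕ) (r : List ℕ) : (insertRow x r).1 ≠ [] := by
  rcases r with _ | ⟨y, r⟩
  · simp [insertRow]
  · rw [insertRow]; split_ifs <;> simp

theorem insertTableau_twoRows {x : ℕ} {r s : List ℕ} (h : r = [] → s = [])
    (hs : ∀ y ∈ (insertRow x r).2, ∀ z ∈ s, z ≤ y) :
    insertTableau x (twoRows r s) =
      (twoRows (insertRow x r).1 (s ++ (insertRow x r).2.toList),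
        (insertRow x r).2.toList.length) := by
  rcases r with _ | ⟨z, r⟩
  · rw [h rfl]; rfl
  · have hne := insertRow_ne_nil x (z :: r)
    rcases hI : insertRow x (z :: r) with ⟨_ | ⟨z', r'⟩, _ | y⟩
    · simp [hI] at hne
    · simp [hI] at hne
    · rcases s with _ | ⟨u, s⟩ <;> simp [twoRows, insertTableau, hI]
    · rw [hI] at hs
      rcases s with _ | ⟨u, s⟩
      · simp [twoRows, insertTableau, hI]
      · have := insertRow_of_forall_le (x := y) (r := u :: s) fun v hv => hs y rfl v hv
        simp [twoRows, insertTableau, hI, this]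

theorem addBox_zero_twoRows {r s : List ℕ} (h : r = [] → s = []) (m : ℕ) :
    addBox m 0 (twoRows r s) = twoRows (r ++ [m]) s := by
  rcases r with _ | ⟨x, r⟩ <;> rcases s with _ | ⟨y, s⟩ <;> simp_all [twoRows, addBox]

theorem addBox_one_twoRows {r s : List ℕ} (h : r ≠ []) (m : ℕ) :
    addBox m 1 (twoRows r s) = twoRows r (s ++ [m]) := by
  rcases r with _ | ⟨x, r⟩ <;> rcases s with _ | ⟨y, s⟩ <;> simp_all [twoRows, addBox]

/-- As long as the entries bumped out of the first row increase, they are put at the end of the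
second row, and the tableaux keep at most two rows. -/
theorem exists_foldl_insertTableau (l : List (ℕ × ℕ)) {r s q t : List ℕ} (h : r = [] → s = [])
    (hq : q.length = r.length) (ht : t.length = s.length)
    (hs : (s ++ (bumps r l).map Prod.fst).Pairwise (· < ·)) :
    ∃ r' q', l.foldl (fun T p =>
          let I := insertTableau p.1 T.1
          (I.1, addBox p.2 I.2 T.2)) (twoRows r s, twoRows q t) =
        (twoRows r' (s ++ (bumps r l).map Prod.fst), twoRows q' (t ++ (bumps r l).map Prod.snd)) ∧
      (r' ++ (bumps r l).map Prod.fst).Perm (r ++ l.map Prod.fst) ∧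
      (q' ++ (bumps r l).map Prod.snd).Perm (q ++ l.map Prod.snd) ∧
      (r' = [] → s ++ (bumps r l).map Prod.fst = []) ∧
      (q' = [] → t ++ (bumps r l).map Prod.snd = []) := by
  induction l generalizing r s q t with
  | nil =>
    refine ⟨r, q, by simp [bumps], by simp [bumps], by simp [bumps], by simpa [bumps] using h, ?_⟩
    rintro rfl
    have hr : r = [] := List.eq_nil_of_length_eq_zero (by simpa using hq.symm)
    rw [h hr] at ht
    simpa [bumps] using ht
  | cons p l ih =>
    have hperm := insertRow_perm p.1 r
    have hne := insertRow_ne_nil p.1 r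
    have hle : ∀ y ∈ (insertRow p.1 r).2, ∀ z ∈ s, z ≤ y := by
      intro y hy z hz
      refine ((List.pairwise_append.1 hs).2.2 z hz y ?_).le
      rw [bumps, List.map_append]
      refine List.mem_append_left _ ?_
      rw [Option.mem_def] at hy
      simp [hy]
    have hlen := hperm.length_eq
    rw [List.foldl_cons]
    simp only [insertTableau_twoRows h hle]
    rcases hI : insertRow p.1 r with ⟨r₁, _ | y⟩
    · simp only [hI, bumps, Option.toList_none, List.map_nil, List.nil_append, List.append_nil,
        List.length_nil, List.length_cons] at hs hperm hne hlen ⊢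
      have hqt : q = [] → t = [] := by
        rintro rfl
        have hr : r = [] := List.eq_nil_of_length_eq_zero (by simpa using hq.symm)
        rw [h hr] at ht
        simpa using ht
      rw [addBox_zero_twoRows hqt]
      obtain ⟨r', q', h1, h2, h3, h4, h5⟩ := ih (r := r₁) (q := q ++ [p.2]) (s := s) (t := t)
        (fun h => absurd h hne) (by simp; omega) ht hs
      refine ⟨r', q', h1, h2.trans ?_, h3.trans (by simp), h4, h5⟩
      exact (hperm.append_right _).trans (by simpa using List.perm_middle.symm)
    · simp only [hI, bumps, Option.toList_some, List.map_cons, List.map_nil, List.length_cons,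
        List.length_nil, Nat.zero_add, List.map_append, List.length_append] at hs hperm hne hlen ⊢
      have hq0 : q ≠ [] := by
        rintro rfl
        have hr : r = [] := List.eq_nil_of_length_eq_zero (by simpa using hq.symm)
        rw [hr] at hI
        simp [insertRow] at hI
      rw [addBox_one_twoRows hq0]
      obtain ⟨r', q', h1, h2, h3, h4, h5⟩ := ih (r := r₁) (q := q) (s := s ++ [y])
        (t := t ++ [p.2]) (fun h => absurd h hne) (by omega) (by simp [ht]) (by simpa using hs)
      refine ⟨r', q', by simpa using h1, ?_, ?_, by simpa using h4, by simpa using h5⟩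
      · have e1 : (r' ++ ([y] ++ (bumps r₁ l).map Prod.fst)).Perm
            (y :: (r' ++ (bumps r₁ l).map Prod.fst)) := by simp
        have e2 : (y :: (r₁ ++ l.map Prod.fst)).Perm ((r₁ ++ [y]) ++ l.map Prod.fst) := by
          simpa using List.perm_middle.symm
        refine e1.trans ((h2.cons y).trans (e2.trans ((hperm.append_right _).trans ?_)))
        simpa using List.perm_middle.symm
      · have e1 : (q' ++ ([p.2] ++ (bumps r₁ l).map Prod.snd)).Perm
            (p.2 :: (q' ++ (bumps r₁ l).map Prod.snd)) := by simp
        exact e1.trans ((h3.cons _).trans (by simpa using List.perm_middle.symm))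

theorem rsk_eq_foldl {n : ℕ} (w : Equiv.Perm (Fin n)) :
    rsk w = (oneLineFrom w 0).foldl (fun T p =>
      let I := insertTableau p.1 T.1
      (I.1, addBox p.2 I.2 T.2)) (twoRows [] [], twoRows [] []) := by
  have : oneLineFrom w 0 = (List.finRange n).map fun j => ((w j : ℕ) + 1, (j : ℕ) + 1) := by
    refine List.ext_getElem (by simp [oneLineFrom]) fun i h1 h2 => ?_
    have hi : i < n := by simpa [oneLineFrom] using h1
    simp [oneLineFrom, oneLine, hi, add_comm 1 i]
  rw [this, List.foldl_map]
  rfl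

theorem map_snd_oneLineFrom_zero {n : ℕ} (w : Equiv.Perm (Fin n)) :
    (oneLineFrom w 0).map Prod.snd = List.range' 1 n := by
  rw [oneLineFrom, List.map_map]
  exact List.map_id _

theorem map_fst_oneLineFrom_zero_perm {n : ℕ} (w : Equiv.Perm (Fin n)) :
    ((oneLineFrom w 0).map Prod.fst).Perm (List.range' 1 n) := by
  have hfst : (oneLineFrom w 0).map Prod.fst = (List.range' 1 n).map (oneLine w) := by
    rw [oneLineFrom, List.map_map]; rfl
  rw [hfst]
  refine List.Subperm.perm_of_length_le ?_ (by simp)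
  refine List.subperm_of_subset (List.Nodup.map (oneLine_injective w) List.nodup_range')
    fun x hx => ?_
  obtain ⟨j, hj, rfl⟩ := List.mem_map.1 hx
  rw [List.mem_range'_1] at hj ⊢
  rw [oneLine, dif_pos (by omega)]
  omega

theorem mem_iff_of_append_perm {n : ℕ} {r s : List ℕ} (h : (r ++ s).Perm (List.range' 1 n)) :
    {x | x ∈ r} = Set.Icc 1 n \ {x | x ∈ s} := by
  have hn := List.nodup_append.1 (h.nodup_iff.2 List.nodup_range')
  ext x
  have hx := h.mem_iff (a := x)
  rw [List.mem_append, List.mem_range'_1] at hx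
  simp only [Set.mem_ofPred_eq, Set.mem_sdiff, Set.mem_Icc]
  constructor
  · intro hr
    exact ⟨by have := hx.1 (.inl hr); omega, fun hs => hn.2.2 x hr x hs rfl⟩
  · rintro ⟨h1, h2⟩
    exact (hx.2 (by omega)).resolve_right h2

end BooleanRSK

theorem theorem4p3 (n : ℕ) (w : Equiv.Perm (Fin n)) (hw : BooleanRSK.IsBoolean w) :
    (∃! L : List (List ℕ), BooleanRSK.IsCanonicalRuns w L) ∧
    ∀ L : List (List ℕ), BooleanRSK.IsCanonicalRuns w L →
      BooleanRSK.IsReducedWord w L.flatten ∧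
      BooleanRSK.rowContents (BooleanRSK.insertionTableau w) 1 = BooleanRSK.leftmostSucc L ∧
      BooleanRSK.rowContents (BooleanRSK.recordingTableau w) 1 = BooleanRSK.rightmostSucc L ∧
      (BooleanRSK.insertionTableau w).length ≤ 2 ∧
      (BooleanRSK.recordingTableau w).length ≤ 2 ∧
      BooleanRSK.rowContents (BooleanRSK.insertionTableau w) 0 =
        Set.Icc 1 n \ BooleanRSK.leftmostSucc L ∧
      BooleanRSK.rowContents (BooleanRSK.recordingTableau w) 0 =
        Set.Icc 1 n \ BooleanRSK.rightmostSucc L := by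
  obtain ⟨s, hs⟩ := BooleanRSK.exists_isReducedWord w
  have hn := hw.nodup hs
  have hpeel : ∀ L, BooleanRSK.IsCanonicalRuns w L → BooleanRSK.Peeling 0 w L :=
    fun L hL => hL.peeling hs.1 hn fun i hi => (hs.1.1 i hi).1
  refine ⟨?_, fun L hL => ?_⟩
  · obtain ⟨L, hL⟩ := BooleanRSK.exists_isCanonicalRuns hs.1 hn
    exact ⟨L, hL, fun L' hL' => (hpeel L' hL').unique (hpeel L hL)⟩
  have hp := hpeel L hL
  obtain ⟨h1, h2, h3⟩ := hp.bumps_oneLineFrom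
  obtain ⟨r, q, e, hr, hq, hr0, hq0⟩ := BooleanRSK.exists_foldl_insertTableau
    (BooleanRSK.oneLineFrom w 0) (r := []) (s := []) (q := []) (t := []) (fun _ => rfl) rfl rfl
    (by simpa using h1)
  rw [← BooleanRSK.rsk_eq_foldl] at e
  rw [List.nil_append] at hr hq
  rw [BooleanRSK.map_snd_oneLineFrom_zero] at hq
  rw [BooleanRSK.insertionTableau, BooleanRSK.recordingTableau, e,
    BooleanRSK.rowContents_twoRows_zero, BooleanRSK.rowContents_twoRows_zero,
    BooleanRSK.rowContents_twoRows_one hr0, BooleanRSK.rowContents_twoRows_one hq0,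
    List.nil_append, List.nil_append, ← h2, ← h3]
  exact ⟨(BooleanRSK.isReducedWord_iff hs.1 hn).2 ⟨hp.flatten.1, hp.flatten.2.1⟩, rfl, rfl,
    BooleanRSK.length_twoRows_le _ _, BooleanRSK.length_twoRows_le _ _,
    BooleanRSK.mem_iff_of_append_perm
      (hr.trans (BooleanRSK.map_fst_oneLineFrom_zero_perm w)),
    BooleanRSK.mem_iff_of_append_perm hq⟩
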